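/- Let $(N,g)$ be a smooth, time-oriented, globally hyperbolic Lorentzian manifold: $g$ has signature $(-,+,\dots,+)$, $N$ is strongly causal, and $J^+(p)\cap J^-(q)$ is compact for all $p,q\in N$. Let $K\subset N$ be compact. Then there is an integer $P\geq 1$, depending only on $(N,g)$ and $K$, with the following property. Let $\gamma_1:J_1\to N$ and $\gamma_2:J_2\to N$ be any two causal geodesics, where $J_1,J_2\subset\mathbb{R}$ are arbitrary intervals, which are not the same geodesic, that is, they are not both (up to affine changes of parameter) segments of one geodesic of $(N,g)$. Then the number of intersection points of $\gamma_1$ and $\gamma_2$ in $K$ is at most $P$: $$ \#\bigl(\gamma_1(J_1)\cap\gamma_2(J_2)\cap K\bigr)\leq P . $$ Here a smooth curve $\gamma$ is causal if $\dot\gamma\neq 0$ and $g(\dot\gamma,\dot\gamma)\leq 0$ everywhere, and $N$ is strongly causal if every neighbourhood $U$ of a point $p\in N$ contains a neighbourhood $V$ of $p$ such that every causal curve segment with end points in $V$ lies in $U$. -/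

import Mathlib

open scoped Manifold ContDiff Topology

noncomputable section

namespace Lorentz

/-- A smooth Lorentzian metric on a smooth manifold `N` modelled on the finite-dimensional real
vector space `E`: a smooth symmetric `(0,2)`-tensor field of signature `(-,+,…,+)`. The signature
condition says that there is a timelike vector on whose orthogonal complement the form is positive
definite. -/
structure LorentzianMetric (E : Type*) [NormedAddCommGroup E] [NormedSpace ℝ E]
    (N : Type*) [TopologicalSpace N] [ChartedSpace E N] [IsManifold 𝓘(ℝ, E) ∞ N] where
  /-- The bilinear form on each tangent space. -/
  val (x : N) : TangentSpace 𝓘(ℝ, E) x →L[ℝ] TangentSpace 𝓘(ℝ, E) x →L[ℝ] ℝ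
  symm (x : N) (v w : TangentSpace 𝓘(ℝ, E) x) : val x v w = val x w v
  signature (x : N) : ∃ v : TangentSpace 𝓘(ℝ, E) x, val x v v < 0 ∧
    ∀ w : TangentSpace 𝓘(ℝ, E) x, val x v w = 0 → w ≠ 0 → 0 < val x w w
  contMDiff : ContMDiff 𝓘(ℝ, E) (𝓘(ℝ, E).prod 𝓘(ℝ, E →L[ℝ] E →L[ℝ] ℝ)) ∞
    (fun x ↦ Bundle.TotalSpace.mk' (E →L[ℝ] E →L[ℝ] ℝ) x (val x))

section

variable {E : Type*} [NormedAddCommGroup E] [NormedSpace ℝ E]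
  {N : Type*} [TopologicalSpace N] [ChartedSpace E N] [IsManifold 𝓘(ℝ, E) ∞ N]

/-- A time orientation of a Lorentzian manifold, given by a smooth timelike vector field. -/
structure TimeOrientation (g : LorentzianMetric E N) where
  /-- The timelike vector field that points to the future. -/
  field (x : N) : TangentSpace 𝓘(ℝ, E) x
  timelike (x : N) : g.val x (field x) (field x) < 0
  contMDiff : ContMDiff 𝓘(ℝ, E) 𝓘(ℝ, E).tangent ∞
    (fun x ↦ (⟨x, field x⟩ : TangentBundle 𝓘(ℝ, E) N))

/-- The velocity vector of the curve `γ` at the parameter `t`. -/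
def velocity (E : Type*) [NormedAddCommGroup E] [NormedSpace ℝ E]
    {N : Type*} [TopologicalSpace N] [ChartedSpace E N] (γ : ℝ → N) (t : ℝ) :
    TangentSpace 𝓘(ℝ, E) (γ t) :=
  mfderiv 𝓘(ℝ, ℝ) 𝓘(ℝ, E) γ t (1 : ℝ)

/-- The curve `γ`, considered on the parameter set `J`, is a smooth causal curve: its velocity is
nonzero and satisfies `g(γ', γ') ≤ 0`. (Smoothness on a closed interval means, as usual, that `γ`
is the restriction of a curve which is smooth at the end points too; the values of `γ` outside of
`J` play no role otherwise.) -/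
def IsCausalOn (g : LorentzianMetric E N) (γ : ℝ → N) (J : Set ℝ) : Prop :=
  ∀ t ∈ J, ContMDiffAt 𝓘(ℝ, ℝ) 𝓘(ℝ, E) ∞ γ t ∧ velocity E γ t ≠ 0 ∧
    g.val (γ t) (velocity E γ t) (velocity E γ t) ≤ 0

/-- A future-pointing smooth causal curve. A causal vector is future-pointing if it lies in the
same half of the causal cone as the time-orienting vector `T`, that is, if `g(T, v) < 0`. -/
def IsFutureCausalOn (g : LorentzianMetric E N) (τ : TimeOrientation g) (γ : ℝ → N)
    (J : Set ℝ) : Prop :=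
  IsCausalOn g γ J ∧ ∀ t ∈ J, g.val (γ t) (τ.field (γ t)) (velocity E γ t) < 0

/-- The causal relation `p ≤ q`: either `p = q` or there is a future-pointing causal path from
`p` to `q`. -/
def CausalLE (g : LorentzianMetric E N) (τ : TimeOrientation g) (p q : N) : Prop :=
  p = q ∨ ∃ (γ : ℝ → N) (a b : ℝ), a < b ∧ IsFutureCausalOn g τ γ (Set.Icc a b) ∧
    γ a = p ∧ γ b = q

/-- The causal future `J⁺(p)`. -/
def causalFuture (g : LorentzianMetric E N) (τ : TimeOrientation g) (p : N) : Set N :=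
  {q | CausalLE g τ p q}

/-- The causal past `J⁻(q)`. -/
def causalPast (g : LorentzianMetric E N) (τ : TimeOrientation g) (q : N) : Set N :=
  {p | CausalLE g τ p q}

/-- Strong causality: every neighbourhood `U` of a point `p` contains a neighbourhood `V` of `p`
such that every causal curve segment with end points in `V` lies entirely in `U`. -/
def StronglyCausal (g : LorentzianMetric E N) : Prop :=
  ∀ p : N, ∀ U ∈ 𝓝 p, ∃ V ∈ 𝓝 p, V ⊆ U ∧
    ∀ (γ : ℝ → N) (a b : ℝ), a ≤ b → IsCausalOn g γ (Set.Icc a b) → γ a ∈ V → γ b ∈ V →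
      ∀ t ∈ Set.Icc a b, γ t ∈ U

/-- Global hyperbolicity: strong causality, and compactness of all causal diamonds
`J⁺(p) ∩ J⁻(q)`. -/
def GloballyHyperbolic (g : LorentzianMetric E N) (τ : TimeOrientation g) : Prop :=
  StronglyCausal g ∧ ∀ p q : N, IsCompact (causalFuture g τ p ∩ causalPast g τ q)

/-- The metric in the local coordinates given by the chart `e`: the bilinear form on `E` at the
point with coordinates `y`, i.e. the pullback of `g` under `e.symm`. -/
def metricInChart (g : LorentzianMetric E N) (e : OpenPartialHomeomorph N E) (y u v : E) : ℝ :=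
  g.val (e.symm y) (mfderiv 𝓘(ℝ, E) 𝓘(ℝ, E) e.symm y u) (mfderiv 𝓘(ℝ, E) 𝓘(ℝ, E) e.symm y v)

/-- The Christoffel symbol of the first kind in the chart `e`, contracted with constant coordinate
vectors: `Γ(u, v; w) = (∂_u g(v, w) + ∂_v g(u, w) - ∂_w g(u, v)) / 2`, which is the value of
`g(∇_u v, w)` for the Levi-Civita connection. -/
def christoffel (g : LorentzianMetric E N) (e : OpenPartialHomeomorph N E) (y u v w : E) : ℝ :=
  (fderiv ℝ (fun z ↦ metricInChart g e z v w) y u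
    + fderiv ℝ (fun z ↦ metricInChart g e z u w) y v
    - fderiv ℝ (fun z ↦ metricInChart g e z u v) y w) / 2

/-- The curve `γ` is a geodesic on the interval `J`: it is smooth, and in every chart `e` of `N` its
coordinate expression `x = e ∘ γ` satisfies the geodesic equation `x'' + Γ(x', x') = 0`, i.e.
`∇_{γ'} γ' = 0`. The equation is written with the index lowered by the (nondegenerate) metric:
`g(x'', w) + Γ(x', x'; w) = 0` for all `w`. -/
def IsGeodesicOn (g : LorentzianMetric E N) (γ : ℝ → N) (J : Set ℝ) : Prop :=
  J.OrdConnected ∧ ∀ t ∈ J, ContMDiffAt 𝓘(ℝ, ℝ) 𝓘(ℝ, E) ∞ γ t ∧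
    ∀ e ∈ atlas E N, γ t ∈ e.source → ∀ w : E,
      metricInChart g e (e (γ t)) (deriv (deriv (fun s ↦ e (γ s))) t) w
        + christoffel g e (e (γ t)) (deriv (fun s ↦ e (γ s)) t) (deriv (fun s ↦ e (γ s)) t) w = 0

/-- A causal geodesic defined on the interval `J` (which may be open, closed, half-open, bounded or
unbounded). -/
def IsCausalGeodesicOn (g : LorentzianMetric E N) (γ : ℝ → N) (J : Set ℝ) : Prop :=
  IsGeodesicOn g γ J ∧ IsCausalOn g γ J

end

/-- The curve `γ₁` on `J₁` is, up to an affine change of parameter, a segment of the curve `γ`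
on `J`. -/
def IsSegmentOf {N : Type*} (γ₁ : ℝ → N) (J₁ : Set ℝ) (γ : ℝ → N) (J : Set ℝ) : Prop :=
  ∃ a b : ℝ, a ≠ 0 ∧ ∀ s ∈ J₁, a * s + b ∈ J ∧ γ₁ s = γ (a * s + b)

/-- The two curves are, up to affine changes of parameter, segments of one and the same geodesic.
For geodesics that are maximally extended this forces them to have the same image. -/
def SameGeodesic {E : Type*} [NormedAddCommGroup E] [NormedSpace ℝ E]
    {N : Type*} [TopologicalSpace N] [ChartedSpace E N] [IsManifold 𝓘(ℝ, E) ∞ N]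
    (g : LorentzianMetric E N) (γ₁ : ℝ → N) (J₁ : Set ℝ) (γ₂ : ℝ → N) (J₂ : Set ℝ) : Prop :=
  ∃ (γ : ℝ → N) (J : Set ℝ), IsGeodesicOn g γ J ∧ IsSegmentOf γ₁ J₁ γ J ∧ IsSegmentOf γ₂ J₂ γ J

end Lorentz

end

/-!
A causal geodesic that leaves a small neighbourhood of a point does not return to a smaller one, by
strong causality. Hence it suffices that inside a small coordinate ball `U` a geodesic segment is
determined, up to affine changes of parameter, by its end points
(`Lorentz.exists_nhds_geodesic_eqOn`). Indeed, let `V ⊆ U` be a neighbourhood such that causal curve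
segments with end points in `V` stay in `U`. If two causal geodesics meet in two points of `V`, then
their segments between these points lie in `U`, so they coincide after an affine change of
parameter. Geodesics that agree on an interval of positive length agree wherever both are defined,
by uniqueness for ordinary differential equations, and they fit together to one geodesic
(`Lorentz.IsGeodesicOn.exists_union`). So two geodesics that are not the same meet at most once in
`V` (`Lorentz.StronglyCausal.exists_nhds_inter_subsingleton`), and the number of such sets `V` needed
to cover `K` bounds the number of intersection points.

In a chart, geodesics solve `x'' = F(x)(x', x')` with `F` smooth; the metric is inverted to bring the
equation to this form. For the uniqueness of the segment with given end points, parametrize by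
`[0, 1]`. There is no bound on the speed to begin with, but a solution of `‖x''‖ ≤ C ‖x'‖²` that
stays in a ball of small radius `r` has speed at most `8r`
(`Lorentz.norm_velocity_le_of_norm_deriv_le`). The difference `d` of two solutions then satisfies
`‖d''‖ ≤ A ‖d‖ + B ‖d'‖` with `A + B < 1`, and vanishes at both ends. Since `d'` has mean zero,
`sup ‖d‖ ≤ sup ‖d'‖ ≤ sup ‖d''‖`, and `d = 0` (`Lorentz.eqOn_Icc_of_endpoints_eq`).
-/

/-! ### Second order equations with quadratic velocity dependence -/

namespace Lorentz

set_option maxSynthPendingDepth 3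

section ODE

open Set Metric

variable {E : Type*} [NormedAddCommGroup E] [NormedSpace ℝ E]

/-- `x` solves the second order equation `x'' = F(x)(x', x')` on the set `I`. Derivatives are
two-sided, also at the end points of `I`. -/
def IsSpraySolutionOn (F : E → E →L[ℝ] E →L[ℝ] E) (x : ℝ → E) (I : Set ℝ) : Prop :=
  ∀ t ∈ I, HasDerivAt x (deriv x t) t ∧
    HasDerivAt (deriv x) (F (x t) (deriv x t) (deriv x t)) t

/-- A curve on `[0, 1]` with `‖x''‖ ≤ C ‖x'‖²` whose image has diameter at most `δ < 1 / (4C)` has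
speed at most `4δ`: before and after the parameter of maximal speed `M`, the curve stays close to
its tangent line for the time `min (1/2) (1/(2CM))`, and moves too far if `M` is large. -/
theorem norm_velocity_le_of_norm_deriv_le {x v a : ℝ → E} {C δ : ℝ} (hC : 0 < C)
    (hδ : 4 * C * δ < 1)
    (hx : ∀ t ∈ Icc (0 : ℝ) 1, HasDerivAt x (v t) t)
    (hv : ∀ t ∈ Icc (0 : ℝ) 1, HasDerivAt v (a t) t)
    (ha : ∀ t ∈ Icc (0 : ℝ) 1, ‖a t‖ ≤ C * ‖v t‖ ^ 2)
    (hd : ∀ s ∈ Icc (0 : ℝ) 1, ∀ t ∈ Icc (0 : ℝ) 1, ‖x t - x s‖ ≤ δ) :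
    ∀ t ∈ Icc (0 : ℝ) 1, ‖v t‖ ≤ 4 * δ := by
  have hvc : ContinuousOn (fun t ↦ ‖v t‖) (Icc 0 1) :=
    fun t ht ↦ (hv t ht).continuousAt.norm.continuousWithinAt
  obtain ⟨s, hs, hmax⟩ := isCompact_Icc.exists_isMaxOn ⟨0, by simp⟩ hvc
  set M := ‖v s‖ with hM
  have hmax : ∀ t ∈ Icc (0 : ℝ) 1, ‖v t‖ ≤ M := fun t ht ↦ hmax ht
  have hM0 : 0 ≤ M := norm_nonneg _
  have key : ∀ t ∈ Icc (0 : ℝ) 1, M * |t - s| ≤ δ + C * M ^ 2 * |t - s| ^ 2 := by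
    intro t ht
    have hsub : uIcc s t ⊆ Icc 0 1 := ordConnected_Icc.uIcc_subset hs ht
    have h1 : ∀ u ∈ uIcc s t, ‖v u - v s‖ ≤ C * M ^ 2 * |t - s| := by
      intro u hu
      have := (convex_uIcc s t).norm_image_sub_le_of_norm_hasDerivWithin_le (f := v) (f' := a)
        (C := C * M ^ 2) (fun w hw ↦ (hv w (hsub hw)).hasDerivWithinAt)
        (fun w hw ↦ (ha w (hsub hw)).trans (by gcongr; exact hmax w (hsub hw)))
        left_mem_uIcc hu
      refine this.trans ?_
      rw [Real.norm_eq_abs]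
      gcongr C * M ^ 2 * ?_
      exact abs_sub_left_of_mem_uIcc hu
    have h2 := (convex_uIcc s t).norm_image_sub_le_of_norm_hasDerivWithin_le
        (f := fun u ↦ x u - u • v s) (f' := fun u ↦ v u - (1 : ℝ) • v s)
        (C := C * M ^ 2 * |t - s|)
        (fun w hw ↦ ((hx w (hsub hw)).sub ((hasDerivAt_id w).smul_const (v s))).hasDerivWithinAt)
        (fun w hw ↦ by simpa using h1 w hw) left_mem_uIcc right_mem_uIcc
    have h3 : (t - s) • v s = (x t - x s) - ((x t - t • v s) - (x s - s • v s)) := by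
      rw [sub_smul]; abel
    have h4 := norm_sub_le (x t - x s) ((x t - t • v s) - (x s - s • v s))
    rw [← h3, norm_smul, Real.norm_eq_abs] at h4
    rw [Real.norm_eq_abs] at h2
    have h5 := hd s hs t ht
    nlinarith
  -- At least one of `s + h`, `s - h` lies in `[0, 1]` when `h ≤ 1/2`.
  have key' : ∀ h, 0 ≤ h → h ≤ 1 / 2 → M * h ≤ δ + C * M ^ 2 * h ^ 2 := by
    intro h h0 h1
    rcases le_total s (1 / 2) with hs' | hs'
    · have := key (s + h) ⟨by linarith [hs.1], by linarith⟩
      simpa [abs_of_nonneg h0] using this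
    · have := key (s - h) ⟨by linarith, by linarith [hs.2]⟩
      simpa [abs_of_nonneg h0] using this
  have hfin : M ≤ 4 * δ := by
    rcases lt_or_ge (C * M) 1 with h | h
    · have := key' (1 / 2) (by norm_num) le_rfl
      nlinarith
    · -- The displacement during the time `1 / (2CM)` would be at least `1 / (4C) > δ`.
      have hMpos : 0 < M := by
        by_contra hcon
        have : M = 0 := le_antisymm (not_lt.1 hcon) hM0
        rw [this] at h; norm_num at h
      have := key' (1 / (2 * (C * M))) (by positivity) (by
        apply one_div_le_one_div_of_le (by norm_num); linarith)
      have e1 : M * (1 / (2 * (C * M))) = 1 / (2 * C) := by field_simp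
      have e2 : C * M ^ 2 * (1 / (2 * (C * M))) ^ 2 = 1 / (4 * C) := by field_simp; norm_num
      rw [e1, e2] at this
      have h6 : 1 / (2 * C) - 1 / (4 * C) = 1 / (4 * C) := by field_simp; norm_num
      have h7 : 1 / (4 * C) ≤ δ := by linarith
      rw [div_le_iff₀ (by positivity)] at h7
      linarith
  exact fun t ht ↦ (hmax t ht).trans hfin

/-- Uniqueness for the Dirichlet problem: two curves on `[0, 1]` with the same end points coincide
if the difference of their accelerations is controlled with constants `A + B < 1`. -/
theorem eqOn_Icc_of_endpoints_eq {x₁ x₂ v₁ v₂ a₁ a₂ : ℝ → E} {A B : ℝ} (hA : 0 ≤ A) (hB : 0 ≤ B)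
    (hAB : A + B < 1)
    (hx₁ : ∀ t ∈ Icc (0 : ℝ) 1, HasDerivAt x₁ (v₁ t) t)
    (hx₂ : ∀ t ∈ Icc (0 : ℝ) 1, HasDerivAt x₂ (v₂ t) t)
    (hv₁ : ∀ t ∈ Icc (0 : ℝ) 1, HasDerivAt v₁ (a₁ t) t)
    (hv₂ : ∀ t ∈ Icc (0 : ℝ) 1, HasDerivAt v₂ (a₂ t) t)
    (ha : ∀ t ∈ Icc (0 : ℝ) 1, ‖a₁ t - a₂ t‖ ≤ A * ‖x₁ t - x₂ t‖ + B * ‖v₁ t - v₂ t‖)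
    (h0 : x₁ 0 = x₂ 0) (h1 : x₁ 1 = x₂ 1) : EqOn x₁ x₂ (Icc 0 1) := by
  have hwc : ContinuousOn (fun t ↦ ‖v₁ t - v₂ t‖) (Icc 0 1) := fun t ht ↦
    ((hv₁ t ht).continuousAt.sub (hv₂ t ht).continuousAt).norm.continuousWithinAt
  obtain ⟨s, hs, hmax⟩ := isCompact_Icc.exists_isMaxOn ⟨0, by simp⟩ hwc
  set W := ‖v₁ s - v₂ s‖ with hW
  have hmax : ∀ t ∈ Icc (0 : ℝ) 1, ‖v₁ t - v₂ t‖ ≤ W := fun t ht ↦ hmax ht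
  have hW0 : 0 ≤ W := norm_nonneg _
  have hconv : Convex ℝ (Icc (0 : ℝ) 1) := convex_Icc 0 1
  have hz : (0 : ℝ) ∈ Icc (0 : ℝ) 1 := by simp
  have ho : (1 : ℝ) ∈ Icc (0 : ℝ) 1 := by simp
  have hd : ∀ t ∈ Icc (0 : ℝ) 1, ‖x₁ t - x₂ t‖ ≤ W := by
    intro t ht
    have := hconv.norm_image_sub_le_of_norm_hasDerivWithin_le (f := fun t ↦ x₁ t - x₂ t)
      (fun w hw ↦ ((hx₁ w hw).sub (hx₂ w hw)).hasDerivWithinAt) hmax hz ht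
    simp only [h0, sub_self, sub_zero, Real.norm_eq_abs, abs_of_nonneg ht.1] at this
    exact this.trans (mul_le_of_le_one_right hW0 ht.2)
  have hvar : ∀ t ∈ Icc (0 : ℝ) 1, ‖(v₁ t - v₂ t) - (v₁ s - v₂ s)‖ ≤ (A + B) * W := by
    intro t ht
    have := hconv.norm_image_sub_le_of_norm_hasDerivWithin_le (f := fun t ↦ v₁ t - v₂ t)
      (C := (A + B) * W)
      (fun w hw ↦ ((hv₁ w hw).sub (hv₂ w hw)).hasDerivWithinAt)
      (fun w hw ↦ (ha w hw).trans (by nlinarith [hd w hw, hmax w hw])) hs ht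
    refine this.trans (mul_le_of_le_one_right (by positivity) ?_)
    rw [Real.norm_eq_abs, abs_le]
    constructor <;> linarith [hs.1, hs.2, ht.1, ht.2]
  -- The velocity difference has mean zero, so its maximum is bounded by its oscillation.
  have hWle : W ≤ (A + B) * W := by
    have := hconv.norm_image_sub_le_of_norm_hasDerivWithin_le
      (f := fun t ↦ (x₁ t - x₂ t) - t • (v₁ s - v₂ s))
      (f' := fun t ↦ (v₁ t - v₂ t) - (1 : ℝ) • (v₁ s - v₂ s))
      (fun w hw ↦ (((hx₁ w hw).sub (hx₂ w hw)).sub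
        ((hasDerivAt_id w).smul_const (v₁ s - v₂ s))).hasDerivWithinAt)
      (fun w hw ↦ by simpa using hvar w hw) hz ho
    simp only [h0, h1, sub_self, zero_smul, one_smul, zero_sub, sub_zero, norm_neg, norm_one,
      mul_one] at this
    exact this
  have hWz : W = 0 := by nlinarith
  intro t ht
  have := hd t ht
  rw [hWz] at this
  exact sub_eq_zero.1 (norm_le_zero_iff.1 this)

theorem norm_quadratic_sub_le {B₁ B₂ : E →L[ℝ] E →L[ℝ] E} {C M : ℝ} (hB₁ : ‖B₁‖ ≤ C)
    {u v : E} (hu : ‖u‖ ≤ M) (hv : ‖v‖ ≤ M) :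
    ‖B₁ u u - B₂ v v‖ ≤ ‖B₁ - B₂‖ * M ^ 2 + 2 * C * M * ‖u - v‖ := by
  have hM : 0 ≤ M := (norm_nonneg u).trans hu
  have hC : 0 ≤ C := (norm_nonneg B₁).trans hB₁
  have e : B₁ u u - B₂ v v = B₁ (u - v) u + B₁ v (u - v) + (B₁ - B₂) v v := by
    simp only [map_sub, sub_apply]; abel
  rw [e]
  have b1 : ‖B₁ (u - v) u‖ ≤ C * ‖u - v‖ * M :=
    (B₁.le_opNorm₂ _ _).trans (by gcongr)
  have b2 : ‖B₁ v (u - v)‖ ≤ C * M * ‖u - v‖ :=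
    (B₁.le_opNorm₂ _ _).trans (by gcongr)
  have b3 : ‖(B₁ - B₂) v v‖ ≤ ‖B₁ - B₂‖ * M * M :=
    ((B₁ - B₂).le_opNorm₂ _ _).trans (by gcongr)
  have := norm_add₃_le (a := B₁ (u - v) u) (b := B₁ v (u - v)) (c := (B₁ - B₂) v v)
  nlinarith

/-- Near a point where `F` is `C¹`, a solution of `x'' = F(x)(x', x')` on `[0, 1]` that stays in a
small ball is determined by its end points. -/
theorem exists_ball_spraySolution_eqOn {F : E → E →L[ℝ] E →L[ℝ] E} {p : E}
    (hF : ContDiffAt ℝ 1 F p) :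
    ∃ r > 0, ∀ x₁ x₂ : ℝ → E, IsSpraySolutionOn F x₁ (Icc 0 1) → IsSpraySolutionOn F x₂ (Icc 0 1) →
      MapsTo x₁ (Icc 0 1) (ball p r) → MapsTo x₂ (Icc 0 1) (ball p r) →
      x₁ 0 = x₂ 0 → x₁ 1 = x₂ 1 → EqOn x₁ x₂ (Icc 0 1) := by
  obtain ⟨K, s, hs, hK⟩ := hF.exists_lipschitzOnWith
  set C := ‖F p‖ + 1 with hCdef
  have hC : 0 < C := by positivity
  have hcont : ContinuousAt F p := hF.continuousAt
  have hbd : ∀ᶠ y in 𝓝 p, ‖F y‖ < C := by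
    exact hcont.norm.eventually (Iio_mem_nhds (lt_add_one _))
  obtain ⟨r₀, hr₀, hball⟩ := Metric.mem_nhds_iff.1 (Filter.inter_mem hs hbd)
  have hlim : ∀ c : ℝ, Filter.Tendsto (fun r : ℝ ↦ c * r) (𝓝[>] 0) (𝓝 0) := fun c ↦ by
    have : Filter.Tendsto (fun r : ℝ ↦ c * r) (𝓝 0) (𝓝 (c * 0)) :=
      (continuous_const_mul c).tendsto 0
    rw [mul_zero] at this
    exact this.mono_left nhdsWithin_le_nhds
  have hlim2 : Filter.Tendsto (fun r : ℝ ↦ K * (8 * r) ^ 2 + 2 * C * (8 * r)) (𝓝[>] 0) (𝓝 0) := by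
    have : Filter.Tendsto (fun r : ℝ ↦ K * (8 * r) ^ 2 + 2 * C * (8 * r)) (𝓝 0)
        (𝓝 (K * (8 * 0) ^ 2 + 2 * C * (8 * 0))) :=
      Continuous.tendsto (by fun_prop) 0
    simp only [mul_zero, ne_eq, OfNat.ofNat_ne_zero, not_false_eq_true, zero_pow, add_zero] at this
    exact this.mono_left nhdsWithin_le_nhds
  obtain ⟨r, ⟨⟨hr1, hr2⟩, hr3⟩, hr⟩ :=
    ((((hlim 1).eventually_lt_const (u := r₀) hr₀).and
      ((hlim (8 * C)).eventually_lt_const (u := 1) one_pos)).and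
      (hlim2.eventually_lt_const (u := 1) one_pos)).and self_mem_nhdsWithin |>.exists
  have hr : 0 < r := hr
  rw [one_mul] at hr1
  have hsub : ball p r ⊆ s ∩ {y | ‖F y‖ < C} := (ball_subset_ball hr1.le).trans hball
  refine ⟨r, hr, fun x₁ x₂ h₁ h₂ m₁ m₂ e0 e1 ↦ ?_⟩
  have hvel : ∀ x : ℝ → E, IsSpraySolutionOn F x (Icc 0 1) → MapsTo x (Icc 0 1) (ball p r) →
      ∀ t ∈ Icc (0 : ℝ) 1, ‖deriv x t‖ ≤ 8 * r := by
    intro x h m t ht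
    have := norm_velocity_le_of_norm_deriv_le (δ := 2 * r) hC (by linarith)
      (fun t ht ↦ (h t ht).1) (fun t ht ↦ (h t ht).2)
      (fun t ht ↦ by
        refine ((F (x t)).le_opNorm₂ _ _).trans ?_
        have : ‖F (x t)‖ ≤ C := le_of_lt (hsub (m ht)).2
        rw [pow_two, mul_assoc]
        gcongr)
      (fun s hs t ht ↦ by
        have h1 := m hs
        have h2 := m ht
        rw [mem_ball] at h1 h2
        rw [← dist_eq_norm]
        linarith [dist_triangle_right (x t) (x s) p]) t ht
    linarith
  refine eqOn_Icc_of_endpoints_eq (A := K * (8 * r) ^ 2) (B := 2 * C * (8 * r)) (by positivity)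
    (by positivity) hr3 (fun t ht ↦ (h₁ t ht).1) (fun t ht ↦ (h₂ t ht).1)
    (fun t ht ↦ (h₁ t ht).2) (fun t ht ↦ (h₂ t ht).2) (fun t ht ↦ ?_) e0 e1
  have hl := hK.norm_sub_le (hsub (m₁ ht)).1 (hsub (m₂ ht)).1
  have := norm_quadratic_sub_le (B₁ := F (x₁ t)) (B₂ := F (x₂ t)) (le_of_lt (hsub (m₁ ht)).2)
    (hvel x₁ h₁ m₁ t ht) (hvel x₂ h₂ m₂ t ht)
  refine this.trans ?_
  have := mul_le_mul_of_nonneg_right hl (sq_nonneg (8 * r))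
  linarith

/-- Local uniqueness to the right for the initial value problem of `x'' = F(x)(x', x')`. -/
theorem eventually_eq_of_spraySolution {F : E → E →L[ℝ] E →L[ℝ] E} {x₁ x₂ : ℝ → E} {a b : ℝ}
    (hab : a < b) (h₁ : IsSpraySolutionOn F x₁ (Icc a b)) (h₂ : IsSpraySolutionOn F x₂ (Icc a b))
    (hF : ContDiffAt ℝ 1 F (x₁ a)) (hx : x₁ a = x₂ a) (hv : deriv x₁ a = deriv x₂ a) :
    ∀ᶠ t in 𝓝[>] a, x₁ t = x₂ t := by
  have hG : ContDiffAt ℝ 1 (fun z : E × E ↦ (z.2, F z.1 z.2 z.2)) (x₁ a, deriv x₁ a) := by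
    have hF' : ContDiffAt ℝ 1 (fun z : E × E ↦ F z.1) (x₁ a, deriv x₁ a) :=
      ContDiffAt.comp (x₁ a, deriv x₁ a) (g := F) hF contDiffAt_fst
    exact contDiffAt_snd.prodMk ((hF'.clm_apply contDiffAt_snd).clm_apply contDiffAt_snd)
  obtain ⟨K, s, hs, hK⟩ := hG.exists_lipschitzOnWith
  have hcont : ∀ x : ℝ → E, IsSpraySolutionOn F x (Icc a b) → ∀ t ∈ Icc a b,
      HasDerivAt (fun t ↦ (x t, deriv x t)) (deriv x t, F (x t) (deriv x t) (deriv x t)) t :=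
    fun x h t ht ↦ (h t ht).1.prodMk (h t ht).2
  have ha : a ∈ Icc a b := left_mem_Icc.2 hab.le
  have m₁ : ∀ᶠ t in 𝓝 a, (x₁ t, deriv x₁ t) ∈ s := (hcont x₁ h₁ a ha).continuousAt hs
  have m₂ : ∀ᶠ t in 𝓝 a, (x₂ t, deriv x₂ t) ∈ s :=
    (hcont x₂ h₂ a ha).continuousAt (by rw [← hx, ← hv]; exact hs)
  obtain ⟨ε, hε, hεs⟩ := Metric.eventually_nhds_iff.1 (m₁.and m₂)
  set c := min b (a + ε / 2) with hc
  have hac : a < c := lt_min hab (by linarith)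
  have hcb : Icc a c ⊆ Icc a b := Icc_subset_Icc_right (min_le_left _ _)
  have hmem : ∀ t ∈ Ico a c, dist t a < ε := fun t ht ↦ by
    rw [Real.dist_eq, abs_of_nonneg (by linarith [ht.1])]
    linarith [ht.2, min_le_right b (a + ε / 2)]
  have := ODE_solution_unique_of_mem_Icc_right (v := fun _ z ↦ (z.2, F z.1 z.2 z.2))
    (s := fun _ ↦ s) (a := a) (b := c) (fun _ _ ↦ hK)
    (fun t ht ↦ (hcont x₁ h₁ t (hcb ht)).continuousAt.continuousWithinAt)
    (fun t ht ↦ (hcont x₁ h₁ t (hcb (Ico_subset_Icc_self ht))).hasDerivWithinAt)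
    (fun t ht ↦ (hεs (hmem t ht)).1)
    (fun t ht ↦ (hcont x₂ h₂ t (hcb ht)).continuousAt.continuousWithinAt)
    (fun t ht ↦ (hcont x₂ h₂ t (hcb (Ico_subset_Icc_self ht))).hasDerivWithinAt)
    (fun t ht ↦ (hεs (hmem t ht)).2) (by rw [hx, hv])
  filter_upwards [Ioc_mem_nhdsGT hac] with t ht
  exact congrArg Prod.fst (this (Ioc_subset_Icc_self ht))

end ODE

end Lorentz

/-! ### The geodesic equation in a chart -/

namespace Lorentz

set_option maxSynthPendingDepth 3

section Chart

open Set

variable {E : Type*} [NormedAddCommGroup E] [NormedSpace ℝ E]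
  {N : Type*} [TopologicalSpace N] [ChartedSpace E N] [IsManifold 𝓘(ℝ, E) ∞ N]

/-- `metricInChart`, bundled as a bilinear form on `E`. -/
noncomputable def metricForm (g : LorentzianMetric E N) (e : OpenPartialHomeomorph N E) (y : E) :
    E →L[ℝ] E →L[ℝ] ℝ :=
  letI D : E →L[ℝ] E := mfderiv 𝓘(ℝ, E) 𝓘(ℝ, E) e.symm y
  letI G : E →L[ℝ] E →L[ℝ] ℝ := g.val (e.symm y)
  G.bilinearComp D D

theorem metricForm_apply (g : LorentzianMetric E N) (e : OpenPartialHomeomorph N E) (y u v : E) :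
    metricForm g e y u v = metricInChart g e y u v := rfl

/-- The coefficients of the metric in a chart are smooth: they are obtained by evaluating `g` on the
coordinate vector fields `y ↦ d(e⁻¹)_y u` along `e⁻¹`. -/
theorem contDiffOn_metricInChart (g : LorentzianMetric E N) {e : OpenPartialHomeomorph N E}
    (he : e ∈ atlas E N) (u v : E) :
    ContDiffOn ℝ ∞ (fun y ↦ metricInChart g e y u v) e.target := by
  have hs : ContMDiffOn 𝓘(ℝ, E) 𝓘(ℝ, E) ∞ e.symm e.target :=
    contMDiffOn_symm_of_mem_maximalAtlas (IsManifold.subset_maximalAtlas he)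
  have hT : ∀ u : E, ContMDiffOn 𝓘(ℝ, E) 𝓘(ℝ, E).tangent ∞
      (fun y ↦ (⟨e.symm y, mfderiv 𝓘(ℝ, E) 𝓘(ℝ, E) e.symm y u⟩ : TangentBundle 𝓘(ℝ, E) N))
      e.target := by
    intro u
    have h1 := hs.contMDiffOn_tangentMapWithin (m := ∞) le_rfl e.open_target.uniqueMDiffOn
    have h2 : ContMDiff 𝓘(ℝ, E) 𝓘(ℝ, E).tangent ∞
        (fun y : E ↦ (⟨y, u⟩ : TangentBundle 𝓘(ℝ, E) E)) := by
      intro y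
      rw [Bundle.contMDiffAt_totalSpace]
      refine ⟨contMDiffAt_id, ?_⟩
      simpa using contMDiffAt_const
    refine (h1.comp h2.contMDiffOn fun y hy ↦ hy).congr fun y hy ↦ ?_
    simp [tangentMapWithin, mfderivWithin_of_isOpen e.open_target hy]
  intro y hy
  rw [← contMDiffWithinAt_iff_contDiffWithinAt]
  have : ContMDiffWithinAt 𝓘(ℝ, E) (𝓘(ℝ, E).prod 𝓘(ℝ)) ∞
      (fun y ↦ Bundle.TotalSpace.mk' ℝ (E := Bundle.Trivial N ℝ) (e.symm y)
        (metricInChart g e y u v)) e.target y := by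
    apply ContMDiffWithinAt.clm_bundle_apply₂ (F₁ := E) (F₂ := E)
    · exact ContMDiffAt.comp_contMDiffWithinAt y g.contMDiff.contMDiffAt (hs y hy)
    · exact hT u y hy
    · exact hT v y hy
  simp only [Bundle.contMDiffWithinAt_totalSpace] at this
  exact this.2

theorem contDiffOn_metricForm [FiniteDimensional ℝ E] (g : LorentzianMetric E N)
    {e : OpenPartialHomeomorph N E} (he : e ∈ atlas E N) :
    ContDiffOn ℝ ∞ (metricForm g e) e.target :=
  contDiffOn_clm_apply.2 fun u ↦ contDiffOn_clm_apply.2 fun v ↦ contDiffOn_metricInChart g he u v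

/-- The metric is nondegenerate: with `v` the timelike vector of the signature condition, a vector
`u ≠ 0` in the radical would be orthogonal to `v` and hence satisfy `g(u, u) > 0`. -/
theorem metricForm_injective (g : LorentzianMetric E N)
    {e : OpenPartialHomeomorph N E} (he : e ∈ atlas E N) {y : E} (hy : y ∈ e.target) :
    Function.Injective (metricForm g e y) := by
  have hmd : e.MDifferentiable 𝓘(ℝ, E) 𝓘(ℝ, E) := mdifferentiable_of_mem_atlas he
  rw [injective_iff_map_eq_zero]
  intro u hu
  by_contra hne
  have hD : mfderiv 𝓘(ℝ, E) 𝓘(ℝ, E) e.symm y u ≠ 0 := by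
    intro h
    exact hne ((hmd.symm.mfderiv_injective hy) (h.trans (map_zero _).symm))
  have hz : ∀ w, g.val (e.symm y) (mfderiv 𝓘(ℝ, E) 𝓘(ℝ, E) e.symm y u) w = 0 := by
    intro w
    obtain ⟨w, rfl⟩ := hmd.symm.mfderiv_surjective hy w
    exact DFunLike.congr_fun hu w
  obtain ⟨v, -, hv⟩ := g.signature (e.symm y)
  have := hv _ ((g.symm _ _ _).trans (hz v)) hD
  rw [hz] at this
  exact lt_irrefl _ this

theorem metricForm_isInvertible [FiniteDimensional ℝ E] (g : LorentzianMetric E N)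
    {e : OpenPartialHomeomorph N E} (he : e ∈ atlas E N) {y : E} (hy : y ∈ e.target) :
    (metricForm g e y).IsInvertible := by
  have hfr : Module.finrank ℝ E = Module.finrank ℝ (E →L[ℝ] ℝ) := by
    rw [← (LinearMap.toContinuousLinearMap (𝕜 := ℝ) (E := E) (F' := ℝ)).finrank_eq]
    exact (Subspace.dual_finrank_eq (K := ℝ) (V := E)).symm
  exact ⟨(LinearEquiv.ofInjectiveOfFinrankEq (metricForm g e y : E →ₗ[ℝ] E →L[ℝ] ℝ)
    (metricForm_injective g he hy) hfr).toContinuousLinearEquiv, by ext; rfl⟩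

/-- A trilinear form whose value at `(v, v, w)` is `christoffel g e y v v w`. The terms with the
derivatives in the directions `u` and `v` coincide for `u = v` and are merged, so that the form need
not be symmetric in its first two arguments. -/
noncomputable def christoffelForm (g : LorentzianMetric E N) (e : OpenPartialHomeomorph N E) (y : E) :
    E →L[ℝ] E →L[ℝ] E →L[ℝ] ℝ :=
  fderiv ℝ (metricForm g e) y - (1 / 2 : ℝ) •
    ContinuousLinearMap.flipₗᵢ ℝ E E ℝ ∘L (fderiv ℝ (metricForm g e) y).flip

theorem christoffelForm_apply_self [FiniteDimensional ℝ E] (g : LorentzianMetric E N)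
    {e : OpenPartialHomeomorph N E} (he : e ∈ atlas E N) {y : E} (hy : y ∈ e.target) (v w : E) :
    christoffelForm g e y v v w = christoffel g e y v v w := by
  have hd : DifferentiableAt ℝ (metricForm g e) y :=
    ((contDiffOn_metricForm g he).contDiffAt (e.open_target.mem_nhds hy)).differentiableAt
      (by simp)
  have key : ∀ a b c : E, fderiv ℝ (fun z ↦ metricInChart g e z a b) y c =
      fderiv ℝ (metricForm g e) y c a b := by
    intro a b c
    have h1 := ((hd.hasFDerivAt.clm_apply (hasFDerivAt_const a y)).clm_apply
      (hasFDerivAt_const b y)).fderiv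
    simp only [metricForm_apply] at h1
    rw [h1]
    simp
  rw [christoffel, key, key]
  simp [christoffelForm]
  ring

/-- The quadratic map `F` on the right-hand side of the geodesic equation `x'' = F(x)(x', x')` in
the chart `e`, i.e. minus the Christoffel symbol of the second kind. -/
noncomputable def spray (g : LorentzianMetric E N) (e : OpenPartialHomeomorph N E) (y : E) :
    E →L[ℝ] E →L[ℝ] E :=
  -(ContinuousLinearMap.compL ℝ E (E →L[ℝ] ℝ) E (metricForm g e y).inverse ∘L christoffelForm g e y)

theorem contDiffAt_spray [FiniteDimensional ℝ E] (g : LorentzianMetric E N)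
    {e : OpenPartialHomeomorph N E} (he : e ∈ atlas E N) {y : E} (hy : y ∈ e.target) :
    ContDiffAt ℝ 1 (spray g e) y := by
  have hG : ContDiffAt ℝ ∞ (metricForm g e) y :=
    (contDiffOn_metricForm g he).contDiffAt (e.open_target.mem_nhds hy)
  have hD : ContDiffAt ℝ 1 (fderiv ℝ (metricForm g e)) y :=
    hG.fderiv_right (by norm_cast)
  have hC : ContDiffAt ℝ 1 (christoffelForm g e) y := by
    refine hD.sub (ContDiffAt.const_smul (1 / 2 : ℝ) (contDiffAt_const.clm_comp ?_))
    exact (ContinuousLinearMap.flipₗᵢ ℝ E E (E →L[ℝ] ℝ)).contDiff.contDiffAt.comp y hD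
  have hI : ContDiffAt ℝ 1 (fun y ↦ (metricForm g e y).inverse) y :=
    ((metricForm_isInvertible g he hy).contDiffAt_map_inverse (n := 1)).comp y
      (hG.of_le (by norm_cast))
  exact (((ContinuousLinearMap.compL ℝ E (E →L[ℝ] ℝ) E).contDiff.contDiffAt.comp y hI).clm_comp
    hC).neg

theorem eq_spray_of_geodesic_equation [FiniteDimensional ℝ E] (g : LorentzianMetric E N)
    {e : OpenPartialHomeomorph N E} (he : e ∈ atlas E N) {y : E} (hy : y ∈ e.target) {v a : E}
    (h : ∀ w, metricInChart g e y a w + christoffel g e y v v w = 0) : a = spray g e y v v := by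
  have h1 : metricForm g e y a = -christoffelForm g e y v v := by
    ext w
    rw [neg_apply, christoffelForm_apply_self g he hy, metricForm_apply]
    linarith [h w]
  have h2 : spray g e y v v = (metricForm g e y).inverse (-christoffelForm g e y v v) := by
    simp [spray]
  rw [h2, ← h1]
  obtain ⟨L, hL⟩ := metricForm_isInvertible g he hy
  rw [← hL]
  simp

/-- In a chart, geodesics solve the geodesic equation in normal form. -/
theorem IsGeodesicOn.isSpraySolutionOn [FiniteDimensional ℝ E] {g : LorentzianMetric E N}
    {γ : ℝ → N} {J I : Set ℝ} (hγ : IsGeodesicOn g γ J) (hI : I ⊆ J)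
    {e : OpenPartialHomeomorph N E} (he : e ∈ atlas E N) (hm : MapsTo γ I e.source) :
    IsSpraySolutionOn (spray g e) (fun t ↦ e (γ t)) I := by
  intro t ht
  obtain ⟨hs, hgeo⟩ := hγ.2 t (hI ht)
  have hx : ContDiffAt ℝ ∞ (fun t ↦ e (γ t)) t := by
    rw [← contMDiffAt_iff_contDiffAt]
    exact (contMDiffAt_of_mem_maximalAtlas (IsManifold.subset_maximalAtlas he) (hm ht)).comp t hs
  refine ⟨(hx.differentiableAt (by simp)).hasDerivAt, ?_⟩
  rw [← eq_spray_of_geodesic_equation g he (e.map_source (hm ht)) (hgeo e he (hm ht))]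
  have : ContDiffAt ℝ 1 (deriv (fun t ↦ e (γ t))) t := by
    have := hx.fderiv_right (m := 1) (by norm_cast)
    exact this.clm_apply contDiffAt_const
  exact (this.differentiableAt (by simp)).hasDerivAt

/-- Every point has a neighbourhood in which a geodesic on `[0, 1]` is determined by its end
points. -/
theorem exists_nhds_geodesic_eqOn [FiniteDimensional ℝ E] (g : LorentzianMetric E N) (p : N) :
    ∃ U ∈ 𝓝 p, ∀ (γ₁ γ₂ : ℝ → N) (J₁ J₂ : Set ℝ), IsGeodesicOn g γ₁ J₁ → IsGeodesicOn g γ₂ J₂ →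
      Icc 0 1 ⊆ J₁ → Icc 0 1 ⊆ J₂ → MapsTo γ₁ (Icc 0 1) U → MapsTo γ₂ (Icc 0 1) U →
      γ₁ 0 = γ₂ 0 → γ₁ 1 = γ₂ 1 → EqOn γ₁ γ₂ (Icc 0 1) := by
  have he := chart_mem_atlas E p
  set e := chartAt E p
  have hp : p ∈ e.source := mem_chart_source E p
  obtain ⟨r, hr, H⟩ := exists_ball_spraySolution_eqOn (contDiffAt_spray g he (e.map_source hp))
  refine ⟨e.source ∩ e ⁻¹' Metric.ball (e p) r, Filter.inter_mem (e.open_source.mem_nhds hp)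
    ((e.continuousAt hp).preimage_mem_nhds (Metric.ball_mem_nhds _ hr)), ?_⟩
  intro γ₁ γ₂ J₁ J₂ h₁ h₂ hJ₁ hJ₂ m₁ m₂ e0 e1 t ht
  have := H (fun t ↦ e (γ₁ t)) (fun t ↦ e (γ₂ t))
    (h₁.isSpraySolutionOn hJ₁ he fun t ht ↦ (m₁ ht).1)
    (h₂.isSpraySolutionOn hJ₂ he fun t ht ↦ (m₂ ht).1)
    (fun t ht ↦ (m₁ ht).2) (fun t ht ↦ (m₂ ht).2) (congrArg e e0) (congrArg e e1) ht
  exact e.injOn (m₁ ht).1 (m₂ ht).1 this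

end Chart

end Lorentz

/-! ### Continuation and gluing of geodesics -/

namespace Lorentz

set_option maxSynthPendingDepth 3

section Geodesic

open Set

variable {E : Type*} [NormedAddCommGroup E] [NormedSpace ℝ E]
  {N : Type*} [TopologicalSpace N] [ChartedSpace E N] [IsManifold 𝓘(ℝ, E) ∞ N]
  {g : LorentzianMetric E N} {γ γ₁ γ₂ : ℝ → N} {J J₁ J₂ : Set ℝ}

theorem deriv_comp_affine (f : ℝ → E) (a b : ℝ) :
    deriv (fun s ↦ f (a * s + b)) = fun s ↦ a • deriv f (a * s + b) := by
  funext s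
  have h1 := deriv_comp_mul_left a (fun u ↦ f (u + b)) s
  have h2 := deriv_comp_add_const f b (a * s)
  rw [h1, h2]

theorem IsGeodesicOn.continuousAt (h : IsGeodesicOn g γ J) {t : ℝ} (ht : t ∈ J) :
    ContinuousAt γ t :=
  (h.2 t ht).1.continuousAt

theorem IsGeodesicOn.comp_affine [FiniteDimensional ℝ E] (h : IsGeodesicOn g γ J) (a b : ℝ) :
    IsGeodesicOn g (fun s ↦ γ (a * s + b)) {s | a * s + b ∈ J} := by
  refine ⟨?_, fun t ht ↦ ?_⟩
  · rcases le_total 0 a with ha | ha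
    · exact h.1.preimage_mono (f := fun s ↦ a * s + b) fun s t hst ↦ by
        simpa using mul_le_mul_of_nonneg_left hst ha
    · exact h.1.preimage_anti (f := fun s ↦ a * s + b) fun s t hst ↦ by
        simpa using mul_le_mul_of_nonpos_left hst ha
  · obtain ⟨hs, hgeo⟩ := h.2 _ ht
    have haff : ContDiff ℝ ∞ (fun s : ℝ ↦ a * s + b) := by fun_prop
    refine ⟨hs.comp t haff.contDiffAt.contMDiffAt, fun e he hsrc w ↦ ?_⟩
    have key := hgeo e he hsrc w
    have hy := e.map_source hsrc
    have d1 := deriv_comp_affine (fun u ↦ e (γ u)) a b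
    have d2 : deriv (deriv fun s ↦ e (γ (a * s + b))) t =
        a • a • deriv (deriv fun u ↦ e (γ u)) (a * t + b) := by
      rw [d1]
      have := congrFun (deriv_comp_affine (deriv fun u ↦ e (γ u)) a b) t
      rw [← this]
      exact deriv_fun_const_smul_field a _
    rw [d2, d1]
    simp only [← metricForm_apply, ← christoffelForm_apply_self g he hy] at key ⊢
    simp only [map_smul, smul_apply, smul_eq_mul]
    linear_combination a * a * key

/-- Agreement of two geodesics on `[a, c]` propagates beyond `c`: the one-sided derivatives at `c`
agree, so both solve the same initial value problem in a chart. -/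
theorem IsGeodesicOn.eventually_eq_right [FiniteDimensional ℝ E]
    (h₁ : IsGeodesicOn g γ₁ J₁) (h₂ : IsGeodesicOn g γ₂ J₂) {a c b : ℝ} (hac : a < c) (hcb : c < b)
    (hJ₁ : Icc c b ⊆ J₁) (hJ₂ : Icc c b ⊆ J₂) (heq : EqOn γ₁ γ₂ (Icc a c)) :
    ∀ᶠ t in 𝓝[>] c, γ₁ t = γ₂ t := by
  have he := chart_mem_atlas E (γ₁ c)
  have hsrc := mem_chart_source E (γ₁ c)
  set e := chartAt E (γ₁ c)
  have hc : c ∈ Icc c b := left_mem_Icc.2 hcb.le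
  have hγ : γ₁ c = γ₂ c := heq (right_mem_Icc.2 hac.le)
  have m₁ : ∀ᶠ t in 𝓝 c, γ₁ t ∈ e.source :=
    h₁.continuousAt (hJ₁ hc) (e.open_source.mem_nhds hsrc)
  have m₂ : ∀ᶠ t in 𝓝 c, γ₂ t ∈ e.source :=
    h₂.continuousAt (hJ₂ hc) (e.open_source.mem_nhds (hγ ▸ hsrc))
  obtain ⟨ε, hε, hεs⟩ := Metric.eventually_nhds_iff.1 (m₁.and m₂)
  set d := min b (c + ε / 2) with hd
  have hcd : c < d := lt_min hcb (by linarith)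
  have hsub : Icc c d ⊆ Icc c b := Icc_subset_Icc_right (min_le_left _ _)
  have hmem : ∀ t ∈ Icc c d, γ₁ t ∈ e.source ∧ γ₂ t ∈ e.source := fun t ht ↦ hεs <| by
    rw [Real.dist_eq, abs_of_nonneg (by linarith [ht.1])]
    linarith [ht.2, min_le_right b (c + ε / 2)]
  have s₁ := h₁.isSpraySolutionOn (hsub.trans hJ₁) he fun t ht ↦ (hmem t ht).1
  have s₂ := h₂.isSpraySolutionOn (hsub.trans hJ₂) he fun t ht ↦ (hmem t ht).2
  have hcc : c ∈ Icc c d := left_mem_Icc.2 hcd.le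
  have hleft : (fun t ↦ e (γ₁ t)) =ᶠ[𝓝[≤] c] fun t ↦ e (γ₂ t) := by
    filter_upwards [Icc_mem_nhdsLE hac] with t ht
    rw [heq ht]
  have hv : deriv (fun t ↦ e (γ₁ t)) c = deriv (fun t ↦ e (γ₂ t)) c :=
    (uniqueDiffWithinAt_Iic c).eq_deriv _
      ((s₁ c hcc).1.hasDerivWithinAt.congr_of_eventuallyEq hleft.symm (by rw [hγ]))
      (s₂ c hcc).1.hasDerivWithinAt
  filter_upwards [eventually_eq_of_spraySolution hcd s₁ s₂
    (contDiffAt_spray g he (e.map_source hsrc)) (congrArg e hγ) hv,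
    Ioc_mem_nhdsGT hcd] with t ht htd
  have := hmem t (Ioc_subset_Icc_self htd)
  exact e.injOn this.1 this.2 ht

theorem IsGeodesicOn.eq_of_eqOn_Icc_of_le [FiniteDimensional ℝ E] [T2Space N]
    (h₁ : IsGeodesicOn g γ₁ J₁) (h₂ : IsGeodesicOn g γ₂ J₂) {a c : ℝ} (hac : a < c)
    (hJ₁ : Icc a c ⊆ J₁) (hJ₂ : Icc a c ⊆ J₂) (heq : EqOn γ₁ γ₂ (Icc a c)) {t : ℝ}
    (ht₁ : t ∈ J₁) (ht₂ : t ∈ J₂) (hat : a ≤ t) : γ₁ t = γ₂ t := by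
  have ha : a ∈ Icc a c := left_mem_Icc.2 hac.le
  have i₁ : Icc a t ⊆ J₁ := h₁.1.out (hJ₁ ha) ht₁
  have i₂ : Icc a t ⊆ J₂ := h₂.1.out (hJ₂ ha) ht₂
  have hcl : IsClosed ({u | γ₁ u = γ₂ u} ∩ Icc a t) := by
    have := ContinuousOn.preimage_isClosed_of_isClosed (f := fun u ↦ (γ₁ u, γ₂ u))
      (s := Icc a t) (t := diagonal N)
      (fun u hu ↦ ((h₁.continuousAt (i₁ hu)).prodMk (h₂.continuousAt (i₂ hu))).continuousWithinAt)
      isClosed_Icc isClosed_diagonal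
    rw [inter_comm]
    exact this
  refine hcl.Icc_subset_of_forall_mem_nhdsGT_of_Icc_subset (heq ha) (fun u hu hsub ↦ ?_)
    (right_mem_Icc.2 hat)
  rcases lt_or_ge u c with huc | huc
  · filter_upwards [Ioc_mem_nhdsGT huc] with w hw
    exact heq ⟨hu.1.trans hw.1.le, hw.2⟩
  · exact h₁.eventually_eq_right h₂ (hac.trans_le huc) hu.2
      ((Icc_subset_Icc_left hu.1).trans i₁) ((Icc_subset_Icc_left hu.1).trans i₂) hsub

/-- Two geodesics that agree on an interval of positive length agree wherever both are defined. -/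
theorem IsGeodesicOn.eqOn_inter [FiniteDimensional ℝ E] [T2Space N]
    (h₁ : IsGeodesicOn g γ₁ J₁) (h₂ : IsGeodesicOn g γ₂ J₂) {a c : ℝ} (hac : a < c)
    (hJ₁ : Icc a c ⊆ J₁) (hJ₂ : Icc a c ⊆ J₂) (heq : EqOn γ₁ γ₂ (Icc a c)) :
    EqOn γ₁ γ₂ (J₁ ∩ J₂) := by
  rintro t ⟨ht₁, ht₂⟩
  rcases le_total a t with hat | hat
  · exact h₁.eq_of_eqOn_Icc_of_le h₂ hac hJ₁ hJ₂ heq ht₁ ht₂ hat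
  · -- Reversing time reduces this case to the previous one.
    have hm : ∀ s ∈ Icc (-c) (-a), -1 * s + 0 ∈ Icc a c := fun s hs ↦
      ⟨by linarith [hs.2], by linarith [hs.1]⟩
    have := (h₁.comp_affine (-1) 0).eq_of_eqOn_Icc_of_le (h₂.comp_affine (-1) 0)
      (neg_lt_neg hac) (fun s hs ↦ hJ₁ (hm s hs)) (fun s hs ↦ hJ₂ (hm s hs))
      (fun s hs ↦ heq (hm s hs)) (t := -t) (by simpa using ht₁) (by simpa using ht₂) (by linarith)
    simpa using this

/-- The defining condition of a geodesic is local. -/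
theorem IsGeodesicOn.of_locally_eq (hJ : J.OrdConnected)
    (h : ∀ t ∈ J, ∃ (δ : ℝ → N) (I : Set ℝ), IsGeodesicOn g δ I ∧ t ∈ I ∧ γ =ᶠ[𝓝 t] δ) :
    IsGeodesicOn g γ J := by
  refine ⟨hJ, fun t ht ↦ ?_⟩
  obtain ⟨δ, I, hδ, htI, heq⟩ := h t ht
  obtain ⟨hs, hgeo⟩ := hδ.2 t htI
  refine ⟨hs.congr_of_eventuallyEq heq, fun e he hsrc w ↦ ?_⟩
  have h0 : (fun s ↦ e (γ s)) =ᶠ[𝓝 t] fun s ↦ e (δ s) := heq.fun_comp e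
  have ht0 : γ t = δ t := heq.eq_of_nhds
  rw [h0.deriv_eq, h0.deriv.deriv_eq, ht0]
  rw [ht0] at hsrc
  exact hgeo e he hsrc w

theorem subset_or_subset_inter_Ici (hJ₁ : J₁.OrdConnected) (hJ₂ : J₂.OrdConnected) {c : ℝ}
    (h₁ : c ∈ J₁) (h₂ : c ∈ J₂) : J₁ ∩ Ici c ⊆ J₂ ∨ J₂ ∩ Ici c ⊆ J₁ := by
  by_contra! h
  obtain ⟨⟨s, hs, hs'⟩, t, ht, ht'⟩ := And.imp not_subset.1 not_subset.1 h
  rcases le_total s t with hst | hst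
  · exact hs' (hJ₂.out h₂ ht.1 ⟨hs.2, hst⟩)
  · exact ht' (hJ₁.out h₁ hs.1 ⟨ht.2, hst⟩)

theorem subset_or_subset_inter_Iic (hJ₁ : J₁.OrdConnected) (hJ₂ : J₂.OrdConnected) {c : ℝ}
    (h₁ : c ∈ J₁) (h₂ : c ∈ J₂) : J₁ ∩ Iic c ⊆ J₂ ∨ J₂ ∩ Iic c ⊆ J₁ := by
  by_contra! h
  obtain ⟨⟨s, hs, hs'⟩, t, ht, ht'⟩ := And.imp not_subset.1 not_subset.1 h
  rcases le_total s t with hst | hst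
  · exact ht' (hJ₁.out hs.1 h₁ ⟨hst, ht.2⟩)
  · exact hs' (hJ₂.out ht.1 h₂ ⟨hst, hs.2⟩)

/-- Two geodesics that agree on an interval of positive length extend to one geodesic on the union
of their parameter intervals. -/
theorem IsGeodesicOn.exists_union [FiniteDimensional ℝ E] [T2Space N]
    (h₁ : IsGeodesicOn g γ₁ J₁) (h₂ : IsGeodesicOn g γ₂ J₂) {a c : ℝ} (hac : a < c)
    (hJ₁ : Icc a c ⊆ J₁) (hJ₂ : Icc a c ⊆ J₂) (heq : EqOn γ₁ γ₂ (Icc a c)) :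
    ∃ γ : ℝ → N, IsGeodesicOn g γ (J₁ ∪ J₂) ∧ EqOn γ₁ γ J₁ ∧ EqOn γ₂ γ J₂ := by
  classical
  obtain ⟨m, ham, hmc⟩ := exists_between hac
  have hm : m ∈ Icc a c := ⟨ham.le, hmc.le⟩
  have hinter := h₁.eqOn_inter h₂ hac hJ₁ hJ₂ heq
  -- On each side of the common point `m`, the geodesic that lives longer is followed.
  have side : ∀ S : Set ℝ, (J₁ ∩ S ⊆ J₂ ∨ J₂ ∩ S ⊆ J₁) → ∃ (δ : ℝ → N) (I : Set ℝ),
      IsGeodesicOn g δ I ∧ (J₁ ∪ J₂) ∩ S ⊆ I ∧ EqOn γ₁ δ (J₁ ∩ S) ∧ EqOn γ₂ δ (J₂ ∩ S) ∧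
        EqOn γ₁ δ (Icc a c) := by
    rintro S (h | h)
    · refine ⟨γ₂, J₂, h₂, ?_, fun t ht ↦ hinter ⟨ht.1, h ht⟩, fun t _ ↦ rfl, heq⟩
      rintro t ⟨ht | ht, htS⟩
      exacts [h ⟨ht, htS⟩, ht]
    · refine ⟨γ₁, J₁, h₁, ?_, fun t _ ↦ rfl, fun t ht ↦ (hinter ⟨h ht, ht.1⟩).symm, fun t _ ↦ rfl⟩
      rintro t ⟨ht | ht, htS⟩
      exacts [ht, h ⟨ht, htS⟩]
  obtain ⟨δr, Ir, hr, hIr, hr₁, hr₂, hra⟩ :=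
    side _ (subset_or_subset_inter_Ici h₁.1 h₂.1 (hJ₁ hm) (hJ₂ hm))
  obtain ⟨δl, Il, hl, hIl, hl₁, hl₂, hla⟩ :=
    side _ (subset_or_subset_inter_Iic h₁.1 h₂.1 (hJ₁ hm) (hJ₂ hm))
  refine ⟨fun t ↦ if t < m then δl t else δr t, .of_locally_eq ?_ fun t ht ↦ ?_, ?_, ?_⟩
  · exact (IsPreconnected.union m (hJ₁ hm) (hJ₂ hm) h₁.1.isPreconnected
      h₂.1.isPreconnected).ordConnected
  · rcases lt_trichotomy t m with htm | rfl | htm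
    · refine ⟨δl, Il, hl, hIl ⟨ht, htm.le⟩, ?_⟩
      filter_upwards [Iio_mem_nhds htm] with s hs
      exact if_pos hs
    · refine ⟨γ₁, J₁, h₁, hJ₁ hm, ?_⟩
      filter_upwards [Icc_mem_nhds ham hmc] with s hs
      split_ifs
      exacts [(hla hs).symm, (hra hs).symm]
    · refine ⟨δr, Ir, hr, hIr ⟨ht, htm.le⟩, ?_⟩
      filter_upwards [Ioi_mem_nhds htm] with s hs
      exact if_neg (not_lt.2 (le_of_lt hs))
  · intro t ht
    dsimp only
    split_ifs with htm
    exacts [hl₁ ⟨ht, htm.le⟩, hr₁ ⟨ht, not_lt.1 htm⟩]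
  · intro t ht
    dsimp only
    split_ifs with htm
    exacts [hl₂ ⟨ht, htm.le⟩, hr₂ ⟨ht, not_lt.1 htm⟩]

/-! ### Intersections of causal geodesics -/

theorem isSegmentOf_of_eqOn_comp_affine {N : Type*} {γ γ₁ : ℝ → N} {J J₁ : Set ℝ} {a b : ℝ}
    (ha : a ≠ 0) (hJ : {s | a * s + b ∈ J₁} ⊆ J)
    (h : EqOn (fun s ↦ γ₁ (a * s + b)) γ {s | a * s + b ∈ J₁}) : IsSegmentOf γ₁ J₁ γ J := by
  refine ⟨a⁻¹, -(a⁻¹ * b), inv_ne_zero ha, fun s hs ↦ ?_⟩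
  have e : a * (a⁻¹ * s + -(a⁻¹ * b)) + b = s := by field_simp; ring
  have hm : a⁻¹ * s + -(a⁻¹ * b) ∈ {s | a * s + b ∈ J₁} := by
    rw [mem_ofPred_eq, e]; exact hs
  refine ⟨hJ hm, ?_⟩
  have := h hm
  simp only [e] at this
  exact this

theorem lineMap_mem_uIcc (s t : ℝ) {u : ℝ} (hu : u ∈ Icc (0 : ℝ) 1) :
    (t - s) * u + s ∈ uIcc s t := by
  rcases le_total s t with h | h
  · rw [uIcc_of_le h]
    constructor <;> nlinarith [hu.1, hu.2]
  · rw [uIcc_of_ge h]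
    constructor <;> nlinarith [hu.1, hu.2]

/-- Around each point of a strongly causal manifold there is a neighbourhood that contains at most
one common point of any two causal geodesics that are not the same. -/
theorem StronglyCausal.exists_nhds_inter_subsingleton [FiniteDimensional ℝ E] [T2Space N]
    (hg : StronglyCausal g) (p : N) :
    ∃ V ∈ 𝓝 p, ∀ (γ₁ γ₂ : ℝ → N) (J₁ J₂ : Set ℝ),
      IsCausalGeodesicOn g γ₁ J₁ → IsCausalGeodesicOn g γ₂ J₂ → ¬ SameGeodesic g γ₁ J₁ γ₂ J₂ →
      (γ₁ '' J₁ ∩ γ₂ '' J₂ ∩ V).Subsingleton := by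
  obtain ⟨U, hU, huniq⟩ := exists_nhds_geodesic_eqOn g p
  obtain ⟨V, hV, -, hVU⟩ := hg p U hU
  have hseg : ∀ (γ : ℝ → N) (J : Set ℝ), IsCausalGeodesicOn g γ J → ∀ s ∈ J, ∀ t ∈ J, γ s ∈ V →
      γ t ∈ V → MapsTo γ (uIcc s t) U := by
    intro γ J h s hs t ht hsV htV
    have hsub : uIcc s t ⊆ J := h.1.1.uIcc_subset hs ht
    rcases le_total s t with hst | hst
    · rw [uIcc_of_le hst] at hsub ⊢
      exact hVU γ s t hst (fun u hu ↦ h.2 u (hsub hu)) hsV htV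
    · rw [uIcc_of_ge hst] at hsub ⊢
      exact hVU γ t s hst (fun u hu ↦ h.2 u (hsub hu)) htV hsV
  refine ⟨V, hV, fun γ₁ γ₂ J₁ J₂ h₁ h₂ hne ↦ ?_⟩
  rintro x ⟨⟨⟨s₁, hs₁, rfl⟩, s₂, hs₂, hs⟩, hxV⟩ y ⟨⟨⟨t₁, ht₁, rfl⟩, t₂, ht₂, ht⟩, hyV⟩
  by_contra hxy
  have hst₁ : t₁ - s₁ ≠ 0 := fun h ↦ hxy (by rw [sub_eq_zero.1 h])
  have hst₂ : t₂ - s₂ ≠ 0 := fun h ↦ hxy (by rw [← hs, ← ht, sub_eq_zero.1 h])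
  have g₁ := h₁.1.comp_affine (t₁ - s₁) s₁
  have g₂ := h₂.1.comp_affine (t₂ - s₂) s₂
  have i₁ : Icc 0 1 ⊆ {u | (t₁ - s₁) * u + s₁ ∈ J₁} := fun u hu ↦
    h₁.1.1.uIcc_subset hs₁ ht₁ (lineMap_mem_uIcc s₁ t₁ hu)
  have i₂ : Icc 0 1 ⊆ {u | (t₂ - s₂) * u + s₂ ∈ J₂} := fun u hu ↦
    h₂.1.1.uIcc_subset hs₂ ht₂ (lineMap_mem_uIcc s₂ t₂ hu)
  have heq := huniq _ _ _ _ g₁ g₂ i₁ i₂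
    (fun u hu ↦ hseg γ₁ J₁ h₁ s₁ hs₁ t₁ ht₁ hxV hyV (lineMap_mem_uIcc s₁ t₁ hu))
    (fun u hu ↦ hseg γ₂ J₂ h₂ s₂ hs₂ t₂ ht₂ (hs ▸ hxV) (ht ▸ hyV) (lineMap_mem_uIcc s₂ t₂ hu))
    (by simpa using hs.symm) (by simpa using ht.symm)
  obtain ⟨γ, hγ, e₁, e₂⟩ := g₁.exists_union g₂ one_pos i₁ i₂ heq
  exact hne ⟨γ, _, hγ, isSegmentOf_of_eqOn_comp_affine hst₁ subset_union_left e₁,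
    isSegmentOf_of_eqOn_comp_affine hst₂ subset_union_right e₂⟩

end Geodesic

end Lorentz

theorem Set.encard_le_card_of_forall_inter_subsingleton {α ι : Type*} {A K : Set α} (s : Finset ι)
    {V : ι → Set α} (hK : K ⊆ ⋃ i ∈ s, V i) (h : ∀ i ∈ s, (A ∩ V i).Subsingleton) :
    (A ∩ K).encard ≤ s.card := by
  have hsub : A ∩ K ⊆ ⋃ i ∈ s, A ∩ V i := fun x hx ↦ by
    obtain ⟨i, hi, hxi⟩ := Set.mem_iUnion₂.1 (hK hx.2)
    exact Set.mem_iUnion₂.2 ⟨i, hi, hx.1, hxi⟩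
  refine (Set.encard_le_encard hsub).trans ?_
  clear hsub hK
  classical
  induction s using Finset.induction_on with
  | empty => simp
  | insert i s hi ih =>
    rw [Finset.set_biUnion_insert, Finset.card_insert_of_notMem hi, Nat.cast_add, Nat.cast_one,
      add_comm]
    refine (Set.encard_union_le _ _).trans (add_le_add ?_ (ih fun j hj ↦ h j (by simp [hj])))
    exact Set.encard_le_one_iff_subsingleton.2 (h i (by simp))

theorem lemmaA1 {E : Type*} [NormedAddCommGroup E] [NormedSpace ℝ E] [FiniteDimensional ℝ E]
    {N : Type*} [TopologicalSpace N] [T2Space N] [SecondCountableTopology N]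
    [ChartedSpace E N] [IsManifold 𝓘(ℝ, E) ∞ N]
    (g : Lorentz.LorentzianMetric E N) (τ : Lorentz.TimeOrientation g)
    (hg : Lorentz.GloballyHyperbolic g τ) (K : Set N) (hK : IsCompact K) :
    ∃ P : ℕ, 1 ≤ P ∧ ∀ (γ₁ γ₂ : ℝ → N) (J₁ J₂ : Set ℝ),
      Lorentz.IsCausalGeodesicOn g γ₁ J₁ → Lorentz.IsCausalGeodesicOn g γ₂ J₂ →
      ¬ Lorentz.SameGeodesic g γ₁ J₁ γ₂ J₂ →
      (γ₁ '' J₁ ∩ γ₂ '' J₂ ∩ K).encard ≤ P := by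
  choose V hV hsub using hg.1.exists_nhds_inter_subsingleton
  obtain ⟨s, -, hs⟩ := hK.elim_nhds_subcover V fun x _ ↦ hV x
  -- The cover is empty if `K` is, whence the `+ 1`.
  refine ⟨s.card + 1, by simp, fun γ₁ γ₂ J₁ J₂ h₁ h₂ hne ↦ ?_⟩
  refine (Set.encard_le_card_of_forall_inter_subsingleton s hs
    fun x _ ↦ hsub x γ₁ γ₂ J₁ J₂ h₁ h₂ hne).trans ?_
  exact_mod_cast Nat.le_succ _
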